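/- Let $p_1,p_2,\dots$ be an infinite sequence of primes such that $p_{i+1}\neq p_i$ for all $i\ge 1$, and for each $i\geq 2$ let $M_i$ be an extra-special group of order $p_i^3$ (a finite $p_i$-group with $M_i'=Z(M_i)$ of order $p_i$). Define finite groups $G_i$ with central subgroups $R_i\le Z(G_i)$ recursively. Let $G_1=R_1$ be the cyclic group of order $p_1$. For $i\ge 2$, let $H=M_i\wr G_{i-1}$ be the wreath product, i.e. the semidirect product of the direct product $B$ of $|G_{i-1}|$ copies of $M_i$ by $G_{i-1}$, which permutes the factors regularly. The group $G_{i-1}$ acts naturally on $B_i=B/[B',H]$, and this action leaves invariant the subgroup $D_i=[B_i,R_{i-1}]$ generated by all elements $b^{-1}b^{r}$ with $b\in B_i$, $r\in R_{i-1}$. Let $G_i=D_i\rtimes G_{i-1}$ be the semidirect product with the induced action, let $R_i=D_i'$ (this is a central subgroup of $G_i$), and regard $G_{i-1}$ as a subgroup of $G_i$ in the natural way. Let $G=\bigcup_i G_i$ be the union (direct limit) of the sequence $G_1\le G_2\le\cdots$. Let $K$ be a field of characteristic $p\geq 0$, and suppose that for every index $i$ there are indices $u,v$ such that $i<u<v$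 and $p_u=p_v\neq p$. Then every nonzero two-sided ideal $I$ of the group algebra $K[G]$ has finite codimension, i.e. $\dim_K K[G]/I<\infty$. -/

import Mathlib

/-- A finite `q`-group `G` is extra-special if `G' = Z(G)` has order `q`. -/
structure IsExtraSpecial (q : ℕ) (G : Type) [Group G] : Prop where
  finite : Finite G
  isPGroup : IsPGroup q G
  commutator_eq_center : commutator G = Subgroup.center G
  card_center : Nat.card (Subgroup.center G) = q

/-- For a group `A` acting on `B` through `φ` and a subgroup `S` of `A`, the subgroup `[B, S]`
of `B` generated by the elements `b⁻¹ * φ s b` with `b ∈ B` and `s ∈ S`. -/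
def actionCommutator {A B : Type} [Group A] [Group B] (φ : A →* MulAut B) (S : Subgroup A) :
    Subgroup B :=
  Subgroup.closure {x | ∃ b : B, ∃ s ∈ S, x = b⁻¹ * φ s b}

theorem actionCommutator_invariant {A B : Type} [Group A] [Group B] (φ : A →* MulAut B)
    (S : Subgroup A) (hS : S ≤ Subgroup.center A) (a : A) {x : B}
    (hx : x ∈ actionCommutator φ S) : φ a x ∈ actionCommutator φ S := by
  have h : actionCommutator φ S ≤ (actionCommutator φ S).comap (φ a).toMonoidHom := by
    refine (Subgroup.closure_le _).2 ?_
    rintro _ ⟨b, s, hs, rfl⟩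
    refine Subgroup.subset_closure ⟨φ a b, s, hs, ?_⟩
    have hc : a * s = s * a := Subgroup.mem_center_iff.1 (hS hs) a
    have : φ a (φ s b) = φ s (φ a b) := by
      rw [← MulAut.mul_apply, ← MulAut.mul_apply, ← map_mul, ← map_mul, hc]
    change φ a (b⁻¹ * φ s b) = _
    rw [map_mul, map_inv, this]
  exact h hx

/-- The restriction of an action `φ` of `A` on `B` to a subgroup of `B` that it leaves invariant. -/
def restrictAction {A B : Type} [Group A] [Group B] (φ : A →* MulAut B) (D : Subgroup B)
    (hD : ∀ a : A, ∀ x ∈ D, φ a x ∈ D) : A →* MulAut D where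
  toFun a :=
    { toFun := fun x => ⟨φ a x, hD a x x.2⟩
      invFun := fun x => ⟨φ a⁻¹ x, hD a⁻¹ x x.2⟩
      left_inv := fun x => Subtype.ext (by simp)
      right_inv := fun x => Subtype.ext (by simp)
      map_mul' := fun x y => Subtype.ext (by simp) }
  map_one' := by ext x; simp
  map_mul' a b := by ext x; simp

/-- The action of `A` on `B ⧸ N` induced by an action `φ` of `A` on `B`, for an invariant normal
subgroup `N`. -/
def quotientAction {A B : Type} [Group A] [Group B] (φ : A →* MulAut B) (N : Subgroup B)
    [N.Normal] (hN : ∀ a : A, ∀ x ∈ N, φ a x ∈ N) : A →* MulAut (B ⧸ N) where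
  toFun a :=
    { toFun := QuotientGroup.map N N (φ a).toMonoidHom (hN a)
      invFun := QuotientGroup.map N N (φ a⁻¹).toMonoidHom (hN a⁻¹)
      left_inv := fun x => by
        induction x using QuotientGroup.induction_on with
        | H b => simp
      right_inv := fun x => by
        induction x using QuotientGroup.induction_on with
        | H b => simp
      map_mul' := fun x y => map_mul _ x y }
  map_one' := by
    ext x
    induction x using QuotientGroup.induction_on with
    | H b => simp
  map_mul' a b := by
    ext x
    induction x using QuotientGroup.induction_on with
    | H b => simp

section Construction

variable (M Γ : Type) [Group M] [Group Γ]

/-- The (regular) wreath product `H = M ≀ Γ`: the semidirect product of the base group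
`B = (Γ → M)`, the direct product of copies of `M` indexed by `Γ`, by `Γ`, which permutes the
factors by translation. -/
abbrev Wreath : Type := (Γ → M) ⋊[mulAutArrow] Γ

/-- The subgroup `[B', H]` of the base group `B` of the wreath product `H = M ≀ Γ`, where the
commutator is formed inside `H`. -/
def baseDerivedCommutator : Subgroup (Γ → M) :=
  Subgroup.comap (SemidirectProduct.inl : (Γ → M) →* Wreath M Γ)
    ⁅(commutator (Γ → M)).map (SemidirectProduct.inl : (Γ → M) →* Wreath M Γ), ⊤⁆

theorem derived_map_normal :
    ((commutator (Γ → M)).map (SemidirectProduct.inl : (Γ → M) →* Wreath M Γ)).Normal := by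
  have hr : (SemidirectProduct.inl : (Γ → M) →* Wreath M Γ).range.Normal := by
    rw [SemidirectProduct.range_inl_eq_ker_rightHom]; infer_instance
  rw [commutator_def, Subgroup.map_commutator, ← MonoidHom.range_eq_map]
  infer_instance

theorem baseDerived_commutator_normal :
    (⁅(commutator (Γ → M)).map (SemidirectProduct.inl : (Γ → M) →* Wreath M Γ),
      (⊤ : Subgroup (Wreath M Γ))⁆).Normal := by
  have := derived_map_normal M Γ
  infer_instance

instance baseDerivedCommutator_normal : (baseDerivedCommutator M Γ).Normal := by
  have := baseDerived_commutator_normal M Γ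
  unfold baseDerivedCommutator
  infer_instance

theorem baseDerivedCommutator_invariant (g : Γ) (x : Γ → M)
    (hx : x ∈ baseDerivedCommutator M Γ) :
    (mulAutArrow : Γ →* MulAut (Γ → M)) g x ∈ baseDerivedCommutator M Γ := by
  have hn := baseDerived_commutator_normal M Γ
  unfold baseDerivedCommutator at hx ⊢
  rw [Subgroup.mem_comap] at hx ⊢
  rw [SemidirectProduct.inl_aut, map_inv]
  exact hn.conj_mem _ hx _

/-- The quotient `B / [B', H]` of the base group of `H = M ≀ Γ`. -/
abbrev BaseQuotient : Type := (Γ → M) ⧸ baseDerivedCommutator M Γ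

/-- The natural action of `Γ` on `B / [B', H]`. -/
def baseQuotientAction : Γ →* MulAut (BaseQuotient M Γ) :=
  quotientAction mulAutArrow (baseDerivedCommutator M Γ) (baseDerivedCommutator_invariant M Γ)

/-- `Γ` fixes the derived subgroup of `B / [B', H]` pointwise, and that subgroup is central. -/
theorem derived_baseQuotient_fixed (x : BaseQuotient M Γ)
    (hx : x ∈ commutator (BaseQuotient M Γ)) :
    (∀ g : Γ, baseQuotientAction M Γ g x = x) ∧ (∀ y, y * x = x * y) := by
  have hmap : commutator (BaseQuotient M Γ) =
      (commutator (Γ → M)).map (QuotientGroup.mk' (baseDerivedCommutator M Γ)) := by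
    rw [commutator_def, commutator_def, Subgroup.map_commutator, ← MonoidHom.range_eq_map,
      MonoidHom.range_eq_top.2 (QuotientGroup.mk'_surjective _)]
  rw [hmap] at hx
  obtain ⟨b, hb, rfl⟩ := hx
  have key : ∀ h : Wreath M Γ, (SemidirectProduct.inl b : Wreath M Γ) * h *
      (SemidirectProduct.inl b)⁻¹ * h⁻¹ ∈
      ⁅(commutator (Γ → M)).map (SemidirectProduct.inl : (Γ → M) →* Wreath M Γ), ⊤⁆ :=
    fun h => Subgroup.commutator_mem_commutator (Subgroup.mem_map_of_mem _ hb)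
      (Subgroup.mem_top h)
  constructor
  · intro g
    change ((mulAutArrow g b : Γ → M) : BaseQuotient M Γ) = (b : BaseQuotient M Γ)
    refine Eq.symm ?_
    have hn := baseDerived_commutator_normal M Γ
    rw [QuotientGroup.eq, baseDerivedCommutator, Subgroup.mem_comap, map_mul, map_inv,
      SemidirectProduct.inl_aut, map_inv]
    have h2 := key (SemidirectProduct.inr g)
    have h3 := hn.conj_mem _ (inv_mem h2) (SemidirectProduct.inl b)⁻¹
    convert h3 using 1
    group
  · intro y
    induction y using QuotientGroup.induction_on with
    | H c =>
      change ((c * b : Γ → M) : BaseQuotient M Γ) = ((b * c : Γ → M) : BaseQuotient M Γ)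
      have hn := baseDerived_commutator_normal M Γ
      rw [QuotientGroup.eq, baseDerivedCommutator, Subgroup.mem_comap]
      have h3 := key (SemidirectProduct.inl c)
      have h4 := hn.conj_mem _ h3 (SemidirectProduct.inl (c * b))⁻¹
      convert h4 using 1
      simp only [map_mul, map_inv]
      group

variable (R : Subgroup Γ) (hR : R ≤ Subgroup.center Γ)

/-- The subgroup `D = [B / [B', H], R]` of `B / [B', H]`, where `H = M ≀ Γ`. -/
def layer : Subgroup (BaseQuotient M Γ) :=
  actionCommutator (baseQuotientAction M Γ) R

/-- The action of `Γ` on `D = [B / [B', H], R]`, for a central subgroup `R` of `Γ`. -/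
def layerAction : Γ →* MulAut (layer M Γ R) :=
  restrictAction (baseQuotientAction M Γ) (layer M Γ R)
    (fun a _ hx => actionCommutator_invariant (baseQuotientAction M Γ) R hR a hx)

/-- The semidirect product of `D = [B / [B', H], R]` by `Γ`. -/
abbrev NextGroup : Type := layer M Γ R ⋊[layerAction M Γ R hR] Γ

/-- The subgroup `D'` of the semidirect product of `D` by `Γ`. -/
def nextCentral : Subgroup (NextGroup M Γ R hR) :=
  (commutator (layer M Γ R)).map SemidirectProduct.inl

theorem nextCentral_le_center :
    nextCentral M Γ R hR ≤ Subgroup.center (NextGroup M Γ R hR) := by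
  rintro _ ⟨d, hd, rfl⟩
  have hd' : (d : BaseQuotient M Γ) ∈ commutator (BaseQuotient M Γ) := by
    have h1 : (commutator (layer M Γ R)).map (layer M Γ R).subtype ≤
        commutator (BaseQuotient M Γ) := by
      rw [commutator_def, commutator_def, Subgroup.map_commutator]
      exact Subgroup.commutator_mono le_top le_top
    exact h1 (Subgroup.mem_map_of_mem _ hd)
  obtain ⟨hfix, hcomm⟩ := derived_baseQuotient_fixed M Γ d hd'
  rw [Subgroup.mem_center_iff]
  intro x
  have hx : layerAction M Γ R hR x.right d = d := Subtype.ext (hfix x.right)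
  have hx' : x.left * d = d * x.left := Subtype.ext (hcomm x.left)
  ext1
  · simp [hx, hx']
  · simp

end Construction

/-- A group together with a distinguished central subgroup. -/
structure Stage where
  carrier : Type
  [group : Group carrier]
  central : Subgroup carrier
  central_le : central ≤ Subgroup.center carrier

attribute [instance] Stage.group

/-- Passing from `(G, R)` to `(D ⋊ G, D')`, where `D = [B / [B', H], R]` and `B` is the base group
of the wreath product `H = M ≀ G`. -/
def Stage.next (S : Stage) (M : Type) [Group M] : Stage where
  carrier := NextGroup M S.carrier S.central S.central_le
  central := nextCentral M S.carrier S.central S.central_le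
  central_le := nextCentral_le_center M S.carrier S.central S.central_le

/-- The tower of groups attached to primes `p 0, p 1, …` and groups `M 0, M 1, …`:
`tower p M 0` is the cyclic group of order `p 0` (with the whole group as central subgroup), and
`tower p M (n + 1)` is built from `tower p M n` and the wreath product `M n ≀ tower p M n`.
The intended use is with `M n` extra-special of order `(p (n + 1)) ^ 3`. -/
def tower (p : ℕ → ℕ) (M : ℕ → Type) [∀ n, Group (M n)] : ℕ → Stage
  | 0 =>
    { carrier := Multiplicative (ZMod (p 0))
      central := ⊤
      central_le := fun x _ => Subgroup.mem_center_iff.2 fun y => mul_comm y x }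
  | n + 1 => (tower p M n).next (M n)

section Limit

variable (p : ℕ → ℕ) (M : ℕ → Type) [∀ n, Group (M n)]

/-- The natural embedding of each group of the tower as the complement in the next one. -/
def towerSucc (n : ℕ) : (tower p M n).carrier →* (tower p M (n + 1)).carrier :=
  (SemidirectProduct.inr : (tower p M n).carrier →*
    NextGroup (M n) (tower p M n).carrier (tower p M n).central (tower p M n).central_le)

theorem towerSucc_injective (n : ℕ) : Function.Injective (towerSucc p M n) :=
  SemidirectProduct.inr_injective

/-- The composite embeddings in the tower. -/
def towerMap (m n : ℕ) (h : m ≤ n) : (tower p M m).carrier →* (tower p M n).carrier :=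
  Nat.leRecOn (C := fun k => (tower p M m).carrier →* (tower p M k).carrier) h
    (fun {k} f => (towerSucc p M k).comp f) (MonoidHom.id _)

theorem towerMap_self (m : ℕ) (x : (tower p M m).carrier) : towerMap p M m m le_rfl x = x := by
  rw [towerMap, Nat.leRecOn_self]; rfl

theorem towerMap_succ (m n : ℕ) (h : m ≤ n) (x : (tower p M m).carrier) :
    towerMap p M m (n + 1) (h.trans n.le_succ) x = towerSucc p M n (towerMap p M m n h x) := by
  rw [towerMap, Nat.leRecOn_succ h]; rfl

instance towerMap_directedSystem :
    DirectedSystem (fun n => (tower p M n).carrier) (fun m n h => towerMap p M m n h) where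
  map_self m x := towerMap_self p M m x
  map_map n k m hmk hkn x := by
    induction hkn with
    | refl => exact towerMap_self p M k _
    | step h ih =>
      rw [towerMap_succ p M k _ h, towerMap_succ p M m _ (hmk.trans h), ← ih]

/-- The direct limit (union) of the tower. -/
abbrev towerLimit : Type :=
  DirectLimit (fun n => (tower p M n).carrier) (towerMap p M)

end Limit

/-!
Write `Γ = G_n`, `R = R_n`, `D = D_{n+1}`, so that `G_{n+1} = D ⋊ Γ` with `R_{n+1} = D'` central of
prime order `q = p_{n+1}`, and `q` does not divide `|R|`.

A normal subgroup of the limit `G` that contains some `R_m` has finite index. Indeed, if it contains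
`R`, then for `b` in `B / [B', H]` the map `s ↦ b⁻¹ b^s` from `R` to `D` is a homomorphism modulo
that subgroup, hence trivial because `|R|` is prime to the order of the `q`-group `B`; so the
subgroup contains `D`, and in particular `R_{n+1}` (`inl_mem_of_inr_mem`). By induction it covers
`G` together with `G_m`. It therefore suffices to find `m` such that the nonzero ideal `I` contains
all `r - 1` with `r ∈ R_m`: then `K[G] / I` is spanned by the image of the finite group `G_m`
(`finiteDimensional_quotient_of_exists_mem_idealKernel`).

The ideal meets `K[Γ]` nontrivially for all large `n`; choose `n` with `q` different from the
characteristic. Fix `x` and `m` in `M` with `[x, m] ≠ 1`. Families of powers of `x` whose exponents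
sum to zero over every coset of `R` form an abelian subgroup `A` of `D`, normalized by `Γ`
(`layerPowers`). Two facts about `A` are used.

* The character `a ↦ [a_1, m]` of `A`, where `a_1` is the coordinate at `1`, is fixed by no
  nontrivial element of `Γ` (`exists_evalPairing_ne`).
* No nontrivial element of `A` commutes with the whole of `D` (`eq_one_of_mem_layerPowers`); this is
  the nondegeneracy of the commutator form on `[B, R]`.

Both feed the same elimination argument (`mem_of_sum_mem_of_eliminate`). Given a nonzero element of
`I ∩ K[Γ]`, normalized to have a nonzero coefficient at `1`, the operators
`y ↦ (g b g⁻¹) y - y b` with `b ∈ A` remove the terms at all `g ≠ 1`; what is left is a product of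
elements `g b g⁻¹ - b` of `K[A]`, which is nonzero because of the character
(`exists_mapDomain_mem_of_mapDomain_mem`). In the resulting nonzero element of `I ∩ K[A]`, the
operators `y ↦ d y d⁻¹ - [d, a] y` with `d ∈ D` remove the terms at all `a ≠ 1`, and leave a product
of elements `1 - ζ` with `1 ≠ ζ ∈ R_{n+1}` (`of_sub_one_mem_of_mapDomain_mem`). Since `q` is
invertible in `K`, each `1 - ζ` generates the same idempotent ideal of `K[R_{n+1}]`
(`of_sub_one_mem_of_prod_mem`), so `I` contains all `r - 1` with `r ∈ R_{n+1}`.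
-/

open scoped commutatorElement IsMulCommutative

/-! ### Elimination of terms in ideals of group rings -/

section Elimination

variable {C A ι : Type*} [CommRing C] [Ring A]

/-- If `∑ φ (ℓ i) * e i` lies in `I` and, for every `g ≠ i₀` in the range of summation, some
additive operator preserving `I` acts diagonally on the terms (multiplying the coefficient at `h`
by `χ g h`) and annihilates the term at `g`, then the term at `i₀` can be isolated. -/
theorem mem_of_sum_mem_of_eliminate [DecidableEq ι] (I : Ideal A) (φ : C →+* A) (e : ι → A)
    (χ : ι → ι → C) (i₀ : ι) (S : Finset ι) (hS : i₀ ∉ S) (T : ι → A →+ A)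
    (hTI : ∀ g ∈ S, ∀ y ∈ I, T g y ∈ I)
    (hT : ∀ g ∈ S, ∀ h ∈ insert i₀ S, ∀ c, T g (φ c * e h) = φ (c * χ g h) * e h)
    (hχ : ∀ g ∈ S, χ g g = 0) (ℓ : ι → C)
    (hsum : ∑ h ∈ insert i₀ S, φ (ℓ h) * e h ∈ I) :
    φ (ℓ i₀ * ∏ g ∈ S, χ g i₀) * e i₀ ∈ I := by
  induction S using Finset.induction_on generalizing ℓ with
  | empty => simpa using hsum
  | insert g S hg ih =>
    have hgi : g ∈ insert g S := Finset.mem_insert_self _ _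
    have hi0 : i₀ ∉ S := fun h => hS (Finset.mem_insert_of_mem h)
    have hne : g ∉ insert i₀ S := by
      simp only [Finset.mem_insert, not_or]
      exact ⟨fun h => hS (h ▸ hgi), hg⟩
    have key := hTI g hgi _ hsum
    rw [map_sum, Finset.sum_congr rfl (fun h hh => hT g hgi h hh (ℓ h)),
      Finset.insert_comm, Finset.sum_insert hne, hχ g hgi, mul_zero, map_zero, zero_mul,
      zero_add] at key
    have := ih hi0 (fun g' h' => hTI g' (Finset.mem_insert_of_mem h'))
      (fun g' h' h hh => hT g' (Finset.mem_insert_of_mem h') h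
        (by rw [Finset.insert_comm]; exact Finset.mem_insert_of_mem hh))
      (fun g' h' => hχ g' (Finset.mem_insert_of_mem h')) (fun h => ℓ h * χ g h) key
    rwa [Finset.prod_insert hg, ← mul_assoc]

end Elimination

section PrimeOrder

variable {K Z : Type*} [Field K] [CommGroup Z]

open MonoidAlgebra in
/-- In the group algebra of a group `Z` of prime order not divisible by the characteristic, the
elements `ζ - 1` with `ζ ≠ 1` all generate the same idempotent ideal. -/
theorem of_sub_one_mem_of_prod_mem {ι : Type*} (hZ : (Nat.card Z).Prime)
    (hK : (Nat.card Z : K) ≠ 0) (J : Ideal (MonoidAlgebra K Z)) (S : Finset ι) (z : ι → Z)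
    (hz : ∀ i ∈ S, z i ≠ 1) (hJ : ∏ i ∈ S, (of K Z (z i) - 1) ∈ J) (ζ : Z) :
    of K Z ζ - 1 ∈ J := by
  set q := Nat.card Z with hq
  have : Finite Z := Nat.finite_of_card_ne_zero hZ.ne_zero
  have := Fintype.ofFinite Z
  set s : MonoidAlgebra K Z := ∑ g : Z, of K Z g with hs
  set e : MonoidAlgebra K Z := (q : K)⁻¹ • s with he
  have hgs : ∀ g, of K Z g * s = s := fun g => by
    rw [hs, Finset.mul_sum]
    simp_rw [← map_mul]
    exact Fintype.sum_equiv (Equiv.mulLeft g) _ _ (fun _ => rfl)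
  have hge : ∀ g, (of K Z g - 1) * e = 0 := fun g => by
    rw [he, mul_smul_comm, sub_mul, hgs, one_mul, sub_self, smul_zero]
  have hss : s * s = (q : K) • s := by
    conv_lhs => rw [hs, Finset.sum_mul, Finset.sum_congr rfl fun g _ => hgs g]
    rw [Finset.sum_const, Finset.card_univ, ← Nat.card_eq_fintype_card, Nat.cast_smul_eq_nsmul]
  have hee : IsIdempotentElem e := by
    rw [IsIdempotentElem, he, smul_mul_smul_comm, hss, smul_smul, mul_assoc, inv_mul_cancel₀ hK,
      mul_one]
  have hf : IsIdempotentElem (1 - e) := hee.one_sub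
  -- `1 - e = -(1 / q) ∑ (g - 1)`, and every `g` is a power of `z i`.
  have hdvd : ∀ i ∈ S, (of K Z (z i) - 1) ∣ 1 - e := fun i hi => by
    have h1 : 1 - e = (q : K)⁻¹ • ∑ g : Z, (1 - of K Z g) := by
      rw [Finset.sum_sub_distrib, Finset.sum_const, Finset.card_univ, ← Nat.card_eq_fintype_card,
        ← Nat.cast_smul_eq_nsmul K, smul_sub, smul_smul, inv_mul_cancel₀ hK, one_smul]
    rw [h1, Algebra.smul_def]
    refine Dvd.dvd.mul_left (Finset.dvd_sum fun g _ => ?_) _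
    have hfact : Fact (Nat.card Z).Prime := ⟨hZ⟩
    obtain ⟨k, rfl⟩ : g ∈ Submonoid.powers (z i) := mem_powers_of_prime_card rfl (hz i hi)
    rw [← neg_dvd, neg_sub, map_pow]
    simpa using sub_dvd_pow_sub_pow (1 : MonoidAlgebra K Z) (of K Z (z i)) k
  have hfJ : 1 - e ∈ J := by
    have h2 : (∏ i ∈ S, (of K Z (z i) - 1)) ∣ (1 - e) ^ S.card := by
      rw [← Finset.prod_const]
      exact Finset.prod_dvd_prod_of_dvd _ _ hdvd
    have h3 : (∏ i ∈ S, (of K Z (z i) - 1)) ∣ (1 - e) ^ (S.card + 1) :=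
      h2.trans (pow_dvd_pow _ (Nat.le_succ _))
    rw [hf.pow_succ_eq] at h3
    exact J.mem_of_dvd h3 hJ
  have : of K Z ζ - 1 = (of K Z ζ - 1) * (1 - e) := by rw [mul_sub, hge, mul_one, sub_zero]
  rw [this]
  exact J.mul_mem_left _ hfJ

end PrimeOrder

section GroupAlgebra

open MonoidAlgebra

variable {K G : Type*} [Field K] [Group G]

theorem MonoidAlgebra.commute_mapDomain_subtype_of (Z : Subgroup G) (hZ : Z ≤ Subgroup.center G)
    (c : MonoidAlgebra K Z) (g : G) :
    Commute (mapDomainRingHom K Z.subtype c) (of K G g) := by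
  induction c using MonoidAlgebra.induction_linear with
  | zero => rw [map_zero]; exact Commute.zero_left _
  | add f f' hf hf' => rw [map_add]; exact hf.add_left hf'
  | single z r =>
    have h := Subgroup.mem_center_iff.1 (hZ z.2) g
    simp [Commute, SemiconjBy, of_apply, single_mul_single, h]

/-- Multiplying by group elements, a nonzero element is brought to have a nonzero coefficient
at `1`. -/
theorem MonoidAlgebra.exists_of_mul_coeff_one_ne_zero {y : MonoidAlgebra K G} (hy : y ≠ 0) :
    ∃ g : G, (of K G g * y).coeff 1 ≠ 0 := by
  obtain ⟨a, ha⟩ : ∃ a, y.coeff a ≠ 0 := by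
    by_contra! h
    exact hy (by ext a; simpa using h a)
  refine ⟨a⁻¹, ?_⟩
  rw [of_apply, coeff_single_mul_apply]
  simpa using ha

/-- Let `Z` be a central subgroup of prime order and `A` a subgroup in which no nontrivial element
commutes with all the elements `d` such that `[d, A] ≤ Z`. An ideal meeting the group algebra of
`A` contains `z - 1` for all `z` in `Z`. -/
theorem of_sub_one_mem_of_mapDomain_mem (Z A : Subgroup G) (hZ : Z ≤ Subgroup.center G)
    (hcard : (Nat.card Z).Prime) (hK : (Nat.card Z : K) ≠ 0)
    (hA : ∀ a ∈ A, a ≠ 1 → ∃ d : G, (∀ h ∈ A, ⁅d, h⁆ ∈ Z) ∧ ⁅d, a⁆ ≠ 1)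
    (J : Ideal (MonoidAlgebra K G)) [J.IsTwoSided] (y : MonoidAlgebra K A) (hy : y ≠ 0)
    (hyJ : mapDomainRingHom K A.subtype y ∈ J) (z : G) (hz : z ∈ Z) :
    of K G z - 1 ∈ J := by
  classical
  have : IsMulCommutative Z :=
    ⟨⟨fun a b => Subtype.ext (Subgroup.mem_center_iff.1 (hZ b.2) a)⟩⟩
  obtain ⟨g, hg⟩ := exists_of_mul_coeff_one_ne_zero hy
  set y' := of K A g * y with hy'
  have hyJ' : mapDomainRingHom K A.subtype y' ∈ J := by
    rw [hy', map_mul]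
    exact J.mul_mem_left _ hyJ
  have hA' : ∀ a : A, ∃ d : G, (∀ h ∈ A, ⁅d, h⁆ ∈ Z) ∧ (a ≠ 1 → ⁅d, (a : G)⁆ ≠ 1) := by
    intro a
    by_cases ha : a = 1
    · exact ⟨1, fun h _ => by simp, fun h => absurd ha h⟩
    · obtain ⟨d, hd, hda⟩ := hA a a.2 (fun h => ha (Subtype.ext h))
      exact ⟨d, hd, fun _ => hda⟩
  choose d hd hda using hA'
  let ζ : A → A → Z := fun a h => ⟨⁅d a, (h : G)⁆, hd a h h.2⟩
  let φ := mapDomainRingHom K Z.subtype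
  let χ : A → A → MonoidAlgebra K Z := fun a h => of K Z (ζ a h) - of K Z (ζ a a)
  let T : A → MonoidAlgebra K G →+ MonoidAlgebra K G := fun a =>
    (AddMonoidHom.mulRight (of K G (d a)⁻¹)).comp (AddMonoidHom.mulLeft (of K G (d a))) -
      AddMonoidHom.mulLeft (φ (of K Z (ζ a a)))
  have hφ : ∀ w : Z, φ (of K Z w) = of K G w := fun w => by simp [φ, of_apply]
  have hT : ∀ a y, T a y = of K G (d a) * y * of K G (d a)⁻¹ - φ (of K Z (ζ a a)) * y :=
    fun _ _ => rfl
  have key := mem_of_sum_mem_of_eliminate J φ (fun a : A => of K G (a : G)) χ 1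
    (y'.coeff.support.erase 1) (Finset.notMem_erase _ _) T
    (fun a _ w hw => by
      rw [hT]
      exact J.sub_mem (J.mul_mem_right _ (J.mul_mem_left _ hw)) (J.mul_mem_left _ hw))
    (fun a _ h _ c => by
      have h1 : of K G (d a) * φ c = φ c * of K G (d a) :=
        (commute_mapDomain_subtype_of Z hZ c (d a)).eq.symm
      have h2 : of K G (d a) * of K G (h : G) * of K G (d a)⁻¹ =
          φ (of K Z (ζ a h)) * of K G (h : G) := by
        rw [hφ, ← map_mul, ← map_mul, ← map_mul]
        congr 1
        change _ = ⁅d a, (h : G)⁆ * h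
        rw [commutatorElement_def]
        group
      rw [hT, ← mul_assoc _ (φ c), h1, mul_assoc (φ c), mul_assoc (φ c), h2, ← mul_assoc (φ c),
        ← mul_assoc _ (φ c), ← map_mul, ← map_mul, ← sub_mul, ← map_sub, mul_sub, mul_comm c,
        mul_comm c])
    (fun a _ => sub_self _) (fun a => algebraMap K _ (y'.coeff a)) (by
      rw [Finset.insert_erase (Finsupp.mem_support_iff.2 hg)]
      convert hyJ' using 1
      conv_rhs => rw [← MonoidAlgebra.sum_coeff_single y', map_finsuppSum]
      refine Finset.sum_congr rfl fun a _ => ?_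
      simp [φ, of_apply, single_mul_single])
  have hζ : ∀ a ∈ y'.coeff.support.erase 1, ζ a a ≠ 1 := fun a ha h =>
    hda a (Finset.ne_of_mem_erase ha) (congrArg Subtype.val h)
  have hζ1 : ∀ a, ζ a 1 = 1 := fun a => Subtype.ext (by simp [ζ])
  rw [Subgroup.coe_one, map_one (of K G), mul_one] at key
  -- The coefficient at `1` is a unit, so the product of the elements `1 - [d, a]` lies in `J`.
  have hprod : ∏ a ∈ y'.coeff.support.erase 1, (of K Z (ζ a a) - 1) ∈ J.comap φ := by
    have h3 := (J.comap φ).mul_mem_left (algebraMap K (MonoidAlgebra K Z) (y'.coeff 1)⁻¹)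
      (Ideal.mem_comap.2 key)
    rw [← mul_assoc, ← map_mul, inv_mul_cancel₀ hg, map_one, one_mul] at h3
    refine (J.comap φ).mem_of_dvd (Finset.prod_dvd_prod_of_dvd _ _ fun a _ => ?_) h3
    rw [← neg_dvd, neg_sub]
    simp only [hζ1, map_one, dvd_refl]
  have h4 := of_sub_one_mem_of_prod_mem hcard hK (J.comap φ) _ _ hζ hprod ⟨z, hz⟩
  rw [Ideal.mem_comap, map_sub, map_one, hφ] at h4
  exact h4

/-- Let `Γ` be a group acting by conjugation on an abelian subgroup `A`, and `χ` a homomorphism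
from `A` to a group of prime order such that no nontrivial element of `Γ` fixes `χ`. An ideal
meeting the group algebra of `Γ` also meets that of `A`. -/
theorem exists_mapDomain_mem_of_mapDomain_mem {Γ W : Type*} [Group Γ] [CommGroup W] (j : Γ →* G)
    (A : Subgroup G) [IsMulCommutative A] (hjA : ∀ g, ∀ a ∈ A, j g * a * (j g)⁻¹ ∈ A) (χ : A →* W)
    (hcard : (Nat.card W).Prime) (hK : (Nat.card W : K) ≠ 0)
    (hχ : ∀ g ≠ 1, ∃ a : A, χ ⟨j g * a * (j g)⁻¹, hjA g a a.2⟩ ≠ χ a)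
    (J : Ideal (MonoidAlgebra K G)) [J.IsTwoSided] (y : MonoidAlgebra K Γ) (hy : y ≠ 0)
    (hyJ : mapDomainRingHom K j y ∈ J) :
    ∃ w : MonoidAlgebra K A, w ≠ 0 ∧ mapDomainRingHom K A.subtype w ∈ J := by
  classical
  obtain ⟨g, hg⟩ := exists_of_mul_coeff_one_ne_zero hy
  set y' := of K Γ g * y with hy'
  have hyJ' : mapDomainRingHom K j y' ∈ J := by
    rw [hy', map_mul]
    exact J.mul_mem_left _ hyJ
  have hb : ∀ g, ∃ a : A, g ≠ 1 → χ ⟨j g * a * (j g)⁻¹, hjA g a a.2⟩ ≠ χ a := by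
    intro g
    by_cases hg : g = 1
    · exact ⟨1, fun h => absurd hg h⟩
    · obtain ⟨a, ha⟩ := hχ g hg
      exact ⟨a, fun _ => ha⟩
  choose b hb using hb
  let c : Γ → A → A := fun g a => ⟨j g * a * (j g)⁻¹, hjA g a a.2⟩
  let φ := mapDomainRingHom K A.subtype
  let ψ : Γ → Γ → MonoidAlgebra K A := fun g h => of K A (c g (b g)) - of K A (c h (b g))
  let T : Γ → MonoidAlgebra K G →+ MonoidAlgebra K G := fun g =>
    AddMonoidHom.mulLeft (φ (of K A (c g (b g)))) - AddMonoidHom.mulRight (φ (of K A (b g)))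
  have hT : ∀ g y, T g y = φ (of K A (c g (b g))) * y - y * φ (of K A (b g)) := fun _ _ => rfl
  have hφ : ∀ a : A, φ (of K A a) = of K G a := fun a => by simp [φ, of_apply]
  have key := mem_of_sum_mem_of_eliminate J φ (fun g : Γ => of K G (j g)) ψ 1
    (y'.coeff.support.erase 1) (Finset.notMem_erase _ _) T
    (fun g _ w hw => by
      rw [hT]
      exact J.sub_mem (J.mul_mem_left _ hw) (J.mul_mem_right _ hw))
    (fun g _ h _ w => by
      have h2 : of K G (j h) * φ (of K A (b g)) = φ (of K A (c h (b g))) * of K G (j h) := by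
        rw [hφ, hφ, ← map_mul, ← map_mul]
        congr 1
        change _ = j h * b g * (j h)⁻¹ * j h
        rw [inv_mul_cancel_right]
      rw [hT, mul_assoc (φ w), h2, ← mul_assoc, ← mul_assoc, ← map_mul, ← map_mul, ← sub_mul,
        ← map_sub, mul_sub, mul_comm w (of K A (c g (b g))), mul_comm w (of K A (c h (b g)))])
    (fun g _ => sub_self _) (fun g => algebraMap K _ (y'.coeff g)) (by
      rw [Finset.insert_erase (Finsupp.mem_support_iff.2 hg)]
      convert hyJ' using 1
      conv_rhs => rw [← MonoidAlgebra.sum_coeff_single y', map_finsuppSum]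
      refine Finset.sum_congr rfl fun a _ => ?_
      simp [φ, of_apply, single_mul_single])
  rw [map_one j, map_one (of K G), mul_one] at key
  refine ⟨_, fun h0 => ?_, key⟩
  have hc1 : ∀ a, c 1 a = a := fun a => Subtype.ext (by simp [c])
  -- Pushing forward along `χ` turns the product into one of elements `u - v` with `u ≠ v`.
  let ρ := mapDomainRingHom K χ
  have hρ : ∀ a : A, ρ (of K A a) = of K W (χ a) := fun a => by simp [ρ, of_apply]
  have h1 : ρ (∏ g ∈ y'.coeff.support.erase 1, ψ g 1) = 0 := by
    have h2 := congrArg (fun w => ρ (algebraMap K (MonoidAlgebra K A) (y'.coeff 1)⁻¹ * w)) h0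
    simpa only [← mul_assoc, ← map_mul, inv_mul_cancel₀ hg, map_one, one_mul, mul_zero,
      map_zero] using h2
  rw [map_prod] at h1
  let z : Γ → W := fun g => χ (c g (b g)) * (χ (b g))⁻¹
  have h3 : ∏ g ∈ y'.coeff.support.erase 1, (of K W (z g) - 1) ∈
      (⊥ : Ideal (MonoidAlgebra K W)) := by
    refine Ideal.mem_of_dvd _ (Finset.prod_dvd_prod_of_dvd _ _ fun g _ => ?_) (Ideal.mem_bot.2 h1)
    refine ⟨of K W (χ (b g))⁻¹, ?_⟩
    simp only [ψ, hc1, map_sub, hρ, z]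
    rw [sub_mul, ← map_mul, ← map_mul, mul_inv_cancel, map_one]
  have hz : ∀ g ∈ y'.coeff.support.erase 1, z g ≠ 1 := fun g hg h =>
    hb g (Finset.ne_of_mem_erase hg) (mul_inv_eq_one.1 h)
  have : Finite W := Nat.finite_of_card_ne_zero hcard.ne_zero
  have : Nontrivial W := Finite.one_lt_card_iff_nontrivial.1 hcard.one_lt
  obtain ⟨w, hw⟩ := exists_ne (1 : W)
  have h4 := of_sub_one_mem_of_prod_mem hcard hK ⊥ _ z hz h3 w
  rw [Ideal.mem_bot, sub_eq_zero, ← map_one (of K W)] at h4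
  exact hw (of_injective h4)

end GroupAlgebra

/-! ### The commutator pairing of a group of nilpotency class two -/

section Pairing

variable {M Γ : Type} [Group M]

/-- The commutator of a group of nilpotency class at most two, as a bimultiplicative map into the
centre. -/
def commutatorPairing (hM : commutator M ≤ Subgroup.center M) :
    M →* M →* Subgroup.center M :=
  have hmem : ∀ x y : M, ⁅x, y⁆ ∈ Subgroup.center M := fun _ _ =>
    hM (Subgroup.commutator_mem_commutator (Subgroup.mem_top _) (Subgroup.mem_top _))
  MonoidHom.mk' (fun x => MonoidHom.mk' (fun y => ⟨⁅x, y⁆, hmem x y⟩) (fun y y' => by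
      ext
      have h := Subgroup.mem_center_iff.1 (hmem x y') y
      have h' : ⁅x, y * y'⁆ = ⁅x, y⁆ * (y * ⁅x, y'⁆ * y⁻¹) := by
        simp only [commutatorElement_def]; group
      simp only [Subgroup.coe_mul, h', h, mul_inv_cancel_right])) (fun x x' => by
    ext y
    have h := Subgroup.mem_center_iff.1 (hmem x' y) x
    have h2 := Subgroup.mem_center_iff.1 (hmem x' y) ⁅x, y⁆
    have h' : ⁅x * x', y⁆ = (x * ⁅x', y⁆ * x⁻¹) * ⁅x, y⁆ := by
      simp only [commutatorElement_def]; group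
    simp only [MonoidHom.mk'_apply, MonoidHom.mul_apply, Subgroup.coe_mul, h', h,
      mul_inv_cancel_right, h2])

variable (hM : commutator M ≤ Subgroup.center M)

@[simp]
theorem coe_commutatorPairing (x y : M) : (commutatorPairing hM x y : M) = ⁅x, y⁆ := rfl

theorem commutatorPairing_eq_one_iff (x y : M) : commutatorPairing hM x y = 1 ↔ x * y = y * x := by
  rw [← Subtype.coe_inj, coe_commutatorPairing, Subgroup.coe_one,
    commutatorElement_eq_one_iff_mul_comm]

theorem commutatorPairing_of_mem_center {x : M} (hx : x ∈ Subgroup.center M) (y : M) :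
    commutatorPairing hM x y = 1 :=
  (commutatorPairing_eq_one_iff hM x y).2 (Subgroup.mem_center_iff.1 hx y).symm

theorem mul_eq_commutatorPairing_mul (x y : M) :
    x * y = commutatorPairing hM x y * (y * x) := by
  rw [coe_commutatorPairing, commutatorElement_def]; group

/-! ### The quotient of the base group of the wreath product -/

/-- Families of central elements of `M`, as elements of the base group of the wreath product. -/
def centerPi (M Γ : Type) [Group M] : (Γ → Subgroup.center M) →* (Γ → M) :=
  (Subgroup.center M).subtype.compLeft Γ

@[simp]
theorem centerPi_apply (z : Γ → Subgroup.center M) (h : Γ) : centerPi M Γ z h = z h := rfl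

theorem commutator_le_range_centerPi (hM : commutator M ≤ Subgroup.center M) :
    commutator (Γ → M) ≤ (centerPi M Γ).range := by
  rw [commutator_def, Subgroup.commutator_le]
  intro b _ c _
  exact ⟨fun h => commutatorPairing hM (b h) (c h), rfl⟩

theorem mulAutArrow_eval [Group Γ] (g : Γ) (b : Γ → M) (h : Γ) :
    (mulAutArrow g b : Γ → M) h = b (g⁻¹ * h) := rfl

theorem mulSingle_mem_commutator [DecidableEq Γ] (hM' : Subgroup.center M ≤ commutator M) (h : Γ)
    (z : Subgroup.center M) : Pi.mulSingle h (z : M) ∈ commutator (Γ → M) := by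
  have h1 : (commutator M).map (MonoidHom.mulSingle (fun _ : Γ => M) h) ≤ commutator (Γ → M) := by
    rw [commutator_def, commutator_def, Subgroup.map_commutator]
    exact Subgroup.commutator_mono le_top le_top
  exact h1 (Subgroup.mem_map_of_mem _ (hM' z.2))

/-- When `M' = Z(M)`, the subgroup `[B', H]` consists of the families of central elements with
trivial product. -/
theorem centerPi_mem_baseDerivedCommutator_iff [Group Γ] [Fintype Γ]
    (hM : commutator M = Subgroup.center M)
    (z : Γ → Subgroup.center M) :
    centerPi M Γ z ∈ baseDerivedCommutator M Γ ↔ ∏ h, z h = 1 := by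
  classical
  constructor
  · intro hz
    let P : Subgroup (Γ → M) :=
      ((MonoidHom.mk' (fun z : Γ → Subgroup.center M => ∏ h, z h)
        (fun _ _ => Finset.prod_mul_distrib)).ker).map (centerPi M Γ)
    have hle : ⁅(commutator (Γ → M)).map (SemidirectProduct.inl : (Γ → M) →* Wreath M Γ), ⊤⁆ ≤
        P.map (SemidirectProduct.inl : (Γ → M) →* Wreath M Γ) := by
      refine Subgroup.commutator_le.2 ?_
      rintro _ ⟨b, hb, rfl⟩ ⟨c, g⟩ -
      obtain ⟨w, rfl⟩ := commutator_le_range_centerPi hM.le hb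
      refine ⟨centerPi M Γ (w * fun h => (w (g⁻¹ * h))⁻¹), ⟨_, ?_, rfl⟩, ?_⟩
      · simp only [SetLike.mem_coe, MonoidHom.mem_ker, MonoidHom.mk'_apply, Pi.mul_apply,
          Finset.prod_mul_distrib, Finset.prod_inv_distrib]
        rw [mul_inv_eq_one]
        exact Fintype.prod_equiv (Equiv.mulLeft g) _ _ (fun h => by simp)
      · ext1
        · funext h
          have h2 := Subgroup.mem_center_iff.1 (inv_mem (w (g⁻¹ * h)).2) (c h)
          simp only [commutatorElement_def, SemidirectProduct.mul_left, SemidirectProduct.left_inl,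
            SemidirectProduct.right_inl, SemidirectProduct.inv_left, SemidirectProduct.inv_right,
            map_one, MulAut.one_apply, Pi.mul_apply, map_mul, map_inv,
            mulAutArrow_eval, Pi.inv_apply, centerPi_apply, inv_one,
            Subgroup.coe_inv, mul_assoc]
          change (w h : M) * ((w (g⁻¹ * h) : M))⁻¹ = (w h : M) * (c h * (((w (g⁻¹ * h) : M))⁻¹ *
            (c ((g⁻¹)⁻¹ * (g⁻¹ * h)))⁻¹))
          rw [← mul_assoc (c h), h2]
          simp
        · simp [commutatorElement_def]
    have h2 := hle (Subgroup.mem_comap.1 hz)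
    obtain ⟨b, ⟨w, hw, rfl⟩, hb⟩ := h2
    have h3 := SemidirectProduct.inl_injective hb
    have h4 : w = z := funext fun h => Subtype.ext (congrFun h3 h)
    subst h4
    exact hw
  · intro hz
    have hsingle : ∀ h (w : Subgroup.center M),
        ((Pi.mulSingle h (w : M) : Γ → M) : BaseQuotient M Γ) =
          ((Pi.mulSingle 1 (w : M) : Γ → M) : BaseQuotient M Γ) := by
      intro h w
      have h1 := mulSingle_mem_commutator (Γ := Γ) hM.ge 1 w
      have h2 := (derived_baseQuotient_fixed M Γ
        ((Pi.mulSingle 1 (w : M) : Γ → M) : BaseQuotient M Γ) (by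
          have : (commutator (Γ → M)).map (QuotientGroup.mk' (baseDerivedCommutator M Γ)) ≤
              commutator (BaseQuotient M Γ) := by
            rw [commutator_def, commutator_def, Subgroup.map_commutator]
            exact Subgroup.commutator_mono le_top le_top
          exact this (Subgroup.mem_map_of_mem _ h1))).1 h
      rw [← h2]
      change _ = ((mulAutArrow h (Pi.mulSingle 1 (w : M)) : Γ → M) : BaseQuotient M Γ)
      congr 1
      funext k
      rw [mulAutArrow_eval]
      by_cases hk : k = h
      · subst hk; simp
      · rw [Pi.mulSingle_eq_of_ne hk, Pi.mulSingle_eq_of_ne]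
        rwa [Ne, inv_mul_eq_one, eq_comm]
    -- Both sides are homomorphisms in `z`, compared on the factors.
    let f : (Γ → Subgroup.center M) →* BaseQuotient M Γ :=
      (QuotientGroup.mk' (baseDerivedCommutator M Γ)).comp (centerPi M Γ)
    let f' : (Γ → Subgroup.center M) →* BaseQuotient M Γ :=
      f.comp ((MonoidHom.mulSingle (fun _ : Γ => Subgroup.center M) 1).comp
        (MonoidHom.mk' (fun z : Γ → Subgroup.center M => ∏ h, z h)
        (fun _ _ => Finset.prod_mul_distrib)))
    have hcs : ∀ (h : Γ) (w : Subgroup.center M),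
        centerPi M Γ (Pi.mulSingle h w) = Pi.mulSingle h (w : M) := by
      intro h w
      funext k
      by_cases hk : k = h
      · subst hk; simp
      · simp [Pi.mulSingle_eq_of_ne hk]
    have hff : f = f' := by
      refine MonoidHom.pi_ext fun h w => ?_
      change ((centerPi M Γ (Pi.mulSingle h w) : Γ → M) : BaseQuotient M Γ) =
        ((centerPi M Γ (Pi.mulSingle 1
          (∏ k, Pi.mulSingle (M := fun _ => Subgroup.center M) h w k)) : Γ → M) :
            BaseQuotient M Γ)
      rw [Finset.prod_pi_mulSingle', if_pos (Finset.mem_univ _), hcs, hcs, hsingle]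
    have h3 : f z = 1 := by
      rw [hff]
      change f (Pi.mulSingle 1 (∏ h, z h)) = 1
      rw [hz, Pi.mulSingle_one, map_one]
    exact (QuotientGroup.eq_one_iff _).1 h3

end Pairing

theorem map_prod_eq_zpow_sum {ι W N : Type*} [CommGroup W] [Group N] (φ : W →* N) (S : Finset ι)
    (f : ι → W) (x : N) (n : ι → ℤ) (h : ∀ i, φ (f i) = x ^ n i) :
    φ (∏ i ∈ S, f i) = x ^ ∑ i ∈ S, n i := by
  classical
  induction S using Finset.induction_on with
  | empty => simp
  | insert i S hi ih => rw [Finset.prod_insert hi, Finset.sum_insert hi, map_mul, h, ih, zpow_add]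

section BaseQuotient

variable {M Γ : Type} [Group M] [Group Γ]

/-- The class in `B / [B', H]` of an element of the base group `B`. -/
def baseMk (M Γ : Type) [Group M] [Group Γ] : (Γ → M) →* BaseQuotient M Γ :=
  QuotientGroup.mk' (baseDerivedCommutator M Γ)

theorem baseMk_surjective : Function.Surjective (baseMk M Γ) := QuotientGroup.mk'_surjective _

theorem baseDerivedCommutator_le_range_centerPi (hM : commutator M = Subgroup.center M) :
    baseDerivedCommutator M Γ ≤ (centerPi M Γ).range := by
  intro b hb
  have := derived_map_normal M Γ
  obtain ⟨c, hc, hcb⟩ := Subgroup.commutator_le_left _ _ (Subgroup.mem_comap.1 hb)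
  rw [← SemidirectProduct.inl_injective hcb]
  exact commutator_le_range_centerPi hM.le hc

theorem baseMk_centerPi_eq_one_iff [Fintype Γ] (hM : commutator M = Subgroup.center M)
    (z : Γ → Subgroup.center M) : baseMk M Γ (centerPi M Γ z) = 1 ↔ ∏ h, z h = 1 := by
  rw [← centerPi_mem_baseDerivedCommutator_iff hM]
  exact QuotientGroup.eq_one_iff _

variable (M Γ) in
/-- The map from the centre of `M` to `B / [B', H]` through the coordinate at `1`. Any other
coordinate gives the same map when `M' = Z(M)`. -/
def centerMk [DecidableEq Γ] : Subgroup.center M →* BaseQuotient M Γ :=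
  ((baseMk M Γ).comp (centerPi M Γ)).comp
    (MonoidHom.mulSingle (fun _ : Γ => Subgroup.center M) 1)

theorem centerMk_apply [DecidableEq Γ] (z : Subgroup.center M) :
    centerMk M Γ z = baseMk M Γ (centerPi M Γ (Pi.mulSingle 1 z)) := rfl

theorem centerMk_injective [Finite Γ] [DecidableEq Γ] (hM : commutator M = Subgroup.center M) :
    Function.Injective (centerMk M Γ) := by
  have := Fintype.ofFinite Γ
  rw [injective_iff_map_eq_one]
  intro z hz
  have h := (baseMk_centerPi_eq_one_iff hM _).1 hz
  exact (Finset.prod_pi_mulSingle' (1 : Γ) z Finset.univ).symm.trans h |> fun h' => by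
    rwa [if_pos (Finset.mem_univ _)] at h'

theorem baseMk_centerPi [Fintype Γ] [DecidableEq Γ]
    (hM : commutator M = Subgroup.center M)
    (z : Γ → Subgroup.center M) : baseMk M Γ (centerPi M Γ z) = centerMk M Γ (∏ h, z h) := by
  rw [centerMk_apply, ← mul_inv_eq_one, ← map_inv, ← map_inv, ← map_mul, ← map_mul]
  refine (baseMk_centerPi_eq_one_iff hM _).2 ?_
  simp only [Pi.mul_apply, Pi.inv_apply, Finset.prod_mul_distrib, Finset.prod_inv_distrib]
  rw [Finset.prod_pi_mulSingle', if_pos (Finset.mem_univ _), mul_inv_cancel]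

/-- Commutators in `B / [B', H]` are the products over all coordinates of the commutators in
`M`. -/
theorem baseMk_mul_comm [Fintype Γ] [DecidableEq Γ]
    (hM : commutator M = Subgroup.center M) (b c : Γ → M) :
    baseMk M Γ b * baseMk M Γ c =
      centerMk M Γ (∏ h, commutatorPairing hM.le (b h) (c h)) * (baseMk M Γ c * baseMk M Γ b) := by
  rw [← baseMk_centerPi hM, ← map_mul, ← map_mul, ← map_mul]
  congr 1
  funext h
  exact mul_eq_commutatorPairing_mul hM.le (b h) (c h)

theorem baseMk_commute_iff [Fintype Γ] [DecidableEq Γ]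
    (hM : commutator M = Subgroup.center M) (b c : Γ → M) :
    baseMk M Γ b * baseMk M Γ c = baseMk M Γ c * baseMk M Γ b ↔
      ∏ h, commutatorPairing hM.le (b h) (c h) = 1 := by
  rw [baseMk_mul_comm hM, mul_eq_right, map_eq_one_iff _ (centerMk_injective hM)]

theorem commutator_baseQuotient_le [Fintype Γ] [DecidableEq Γ]
    (hM : commutator M = Subgroup.center M) :
    commutator (BaseQuotient M Γ) ≤ (centerMk M Γ).range := by
  rw [commutator_def, Subgroup.commutator_le]
  intro x _ y _
  obtain ⟨b, rfl⟩ := baseMk_surjective x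
  obtain ⟨c, rfl⟩ := baseMk_surjective y
  refine ⟨∏ h, commutatorPairing hM.le (b h) (c h), ?_⟩
  rw [commutatorElement_def, baseMk_mul_comm hM]
  group

/-- The homomorphism `B / [B', H] → Z(M)` pairing the coordinate at `1` with a fixed element
of `M`. -/
def evalPairing (hM : commutator M = Subgroup.center M) (m : M) :
    BaseQuotient M Γ →* Subgroup.center M :=
  QuotientGroup.lift (baseDerivedCommutator M Γ)
    (((commutatorPairing hM.le).flip m).comp (Pi.evalMonoidHom (fun _ : Γ => M) 1)) (by
      intro b hb
      obtain ⟨z, rfl⟩ := baseDerivedCommutator_le_range_centerPi hM hb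
      exact commutatorPairing_of_mem_center hM.le (z 1).2 m)

theorem evalPairing_baseMk (hM : commutator M = Subgroup.center M) (m : M) (b : Γ → M) :
    evalPairing hM m (baseMk M Γ b) = commutatorPairing hM.le (b 1) m := rfl

theorem inv_mul_mem_layer {R : Subgroup Γ} {s : Γ} (hs : s ∈ R) (y : BaseQuotient M Γ) :
    y⁻¹ * baseQuotientAction M Γ s y ∈ layer M Γ R :=
  Subgroup.subset_closure ⟨y, s, hs, rfl⟩

/-! ### An abelian subgroup of the layer -/

/-- The class of the family of powers of `x` with prescribed exponents. -/
def powFamily (M Γ : Type) [Group M] [Group Γ] (x : M) (n : Γ → ℤ) : BaseQuotient M Γ :=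
  baseMk M Γ (fun h => x ^ n h)

theorem powFamily_zero (x : M) : powFamily M Γ x 0 = 1 :=
  (congrArg (baseMk M Γ) (funext fun _ => zpow_zero x)).trans (map_one _)

theorem powFamily_add (x : M) (n n' : Γ → ℤ) :
    powFamily M Γ x (n + n') = powFamily M Γ x n * powFamily M Γ x n' := by
  rw [powFamily, powFamily, powFamily, ← map_mul]
  exact congrArg _ (funext fun _ => zpow_add x _ _)

theorem powFamily_neg (x : M) (n : Γ → ℤ) : powFamily M Γ x (-n) = (powFamily M Γ x n)⁻¹ := by
  rw [powFamily, powFamily, ← map_inv]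
  exact congrArg _ (funext fun _ => zpow_neg x _)

theorem baseQuotientAction_powFamily (g : Γ) (x : M) (n : Γ → ℤ) :
    baseQuotientAction M Γ g (powFamily M Γ x n) = powFamily M Γ x (fun h => n (g⁻¹ * h)) := rfl

theorem evalPairing_powFamily (hM : commutator M = Subgroup.center M) (m x : M) (n : Γ → ℤ) :
    evalPairing hM m (powFamily M Γ x n) = commutatorPairing hM.le x m ^ n 1 := by
  rw [powFamily, evalPairing_baseMk, map_zpow, MonoidHom.zpow_apply]

theorem powFamily_sub_mem_layer [DecidableEq Γ] (R : Subgroup Γ) {s : Γ} (hs : s ∈ R) (x : M) :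
    powFamily M Γ x (Pi.single s 1 - Pi.single 1 1) ∈ layer M Γ R := by
  have h := inv_mul_mem_layer (M := M) hs (powFamily M Γ x (Pi.single 1 1))
  rw [baseQuotientAction_powFamily, ← powFamily_neg, ← powFamily_add] at h
  convert h using 2
  rw [sub_eq_neg_add]
  congr 1
  funext k
  rw [Pi.single_apply, Pi.single_apply]
  simp only [inv_mul_eq_one, eq_comm]

/-- The elements of the layer that are families of powers of `x`, with exponents summing to zero
over every coset of `R`. -/
def layerPowers (R : Subgroup Γ) [Fintype R] (x : M) : Subgroup (layer M Γ R) where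
  carrier := {d | ∃ n : Γ → ℤ, (∀ h, ∑ s : R, n (s * h) = 0) ∧ (d : BaseQuotient M Γ) =
    powFamily M Γ x n}
  one_mem' := ⟨0, fun h => by simp, (powFamily_zero x).symm⟩
  mul_mem' := by
    rintro d d' ⟨n, hn, hd⟩ ⟨n', hn', hd'⟩
    refine ⟨n + n', fun h => ?_, ?_⟩
    · simp only [Pi.add_apply, Finset.sum_add_distrib, hn, hn', add_zero]
    · rw [powFamily_add, Subgroup.coe_mul, hd, hd']
  inv_mem' := by
    rintro d ⟨n, hn, hd⟩
    refine ⟨-n, fun h => ?_, ?_⟩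
    · simp only [Pi.neg_apply, Finset.sum_neg_distrib, hn, neg_zero]
    · rw [powFamily_neg, Subgroup.coe_inv, hd]

instance (R : Subgroup Γ) [Fintype R] (x : M) : IsMulCommutative (layerPowers R x) := by
  refine ⟨⟨?_⟩⟩
  rintro ⟨d, n, _, hd⟩ ⟨d', n', _, hd'⟩
  refine Subtype.ext (Subtype.ext ?_)
  change (d : BaseQuotient M Γ) * d' = d' * d
  rw [hd, hd', ← powFamily_add, ← powFamily_add, add_comm]

theorem powFamily_sub_mem_layerPowers [DecidableEq Γ] (R : Subgroup Γ) [Fintype R] {s : Γ}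
    (hs : s ∈ R) (x : M) :
    (⟨_, powFamily_sub_mem_layer R hs x⟩ : layer M Γ R) ∈ layerPowers R x := by
  refine ⟨_, fun h => ?_, rfl⟩
  simp only [Pi.sub_apply, Finset.sum_sub_distrib, sub_eq_zero, Pi.single_apply]
  exact Fintype.sum_equiv (Equiv.mulLeft ⟨s⁻¹, inv_mem hs⟩) _ _ fun t => by
    simp [mul_assoc, inv_mul_eq_one, eq_comm]

theorem layerAction_mem_layerPowers (R : Subgroup Γ) [Fintype R] (hR : R ≤ Subgroup.center Γ)
    (x : M) (g : Γ) {d : layer M Γ R} (hd : d ∈ layerPowers R x) :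
    layerAction M Γ R hR g d ∈ layerPowers R x := by
  obtain ⟨n, hn, hd⟩ := hd
  refine ⟨fun h => n (g⁻¹ * h), fun h => ?_, ?_⟩
  · rw [← hn (g⁻¹ * h)]
    refine Finset.sum_congr rfl fun s _ => ?_
    have := Subgroup.mem_center_iff.1 (hR s.2) g⁻¹
    change n (g⁻¹ * (s * h)) = _
    rw [← mul_assoc, ← mul_assoc, this]
  · rw [← baseQuotientAction_powFamily, ← hd]
    rfl

/-- Nondegeneracy of the commutator form. If a family `x ^ n h` commutes with the whole layer, then
`[x, m] ^ n h` depends only on the coset of `h` modulo `R`. As the exponents sum to zero over cosets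
and `|R|` is prime to `q`, all `x ^ n h` are central in `M`, and so the class of the family is
determined by their product, which is `1`. -/
theorem eq_one_of_mem_layerPowers [Fintype Γ] (hM : commutator M = Subgroup.center M) {q : ℕ}
    (hq : Nat.card (Subgroup.center M) = q) (R : Subgroup Γ) [Fintype R]
    (hcop : (Nat.card R).Coprime q) (x : M) {d : layer M Γ R} (hd : d ∈ layerPowers R x)
    (hcomm : ∀ d', d * d' = d' * d) : d = 1 := by
  classical
  obtain ⟨n, hn, hdn⟩ := hd
  have hinv : ∀ (s : R) (h : Γ) (m : M),
      commutatorPairing hM.le x m ^ n (s * h) = commutatorPairing hM.le x m ^ n h := by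
    intro s h m
    have h1 := congrArg Subtype.val
      (hcomm ⟨_, inv_mul_mem_layer s.2 (baseMk M Γ (Pi.mulSingle h m))⟩)
    rw [Subgroup.coe_mul, Subgroup.coe_mul, hdn, powFamily] at h1
    change _ * ((baseMk M Γ (Pi.mulSingle h m))⁻¹ * baseMk M Γ _) =
      ((baseMk M Γ (Pi.mulSingle h m))⁻¹ * baseMk M Γ _) * _ at h1
    rw [← map_inv, ← map_mul, baseMk_commute_iff hM] at h1
    change ∏ h', commutatorPairing hM.le (x ^ n h') ((Pi.mulSingle (M := fun _ : Γ => M) h m h')⁻¹ *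
      Pi.mulSingle (M := fun _ : Γ => M) h m ((s : Γ)⁻¹ * h')) = 1 at h1
    simp only [map_mul, map_inv, map_zpow, MonoidHom.zpow_apply,
      Finset.prod_mul_distrib, Finset.prod_inv_distrib] at h1
    rw [inv_mul_eq_one] at h1
    have h2 : ∀ k,
        ∏ h', commutatorPairing hM.le x (Pi.mulSingle (M := fun _ : Γ => M) k m h') ^ n h' =
          commutatorPairing hM.le x m ^ n k := by
      intro k
      rw [Finset.prod_eq_single k (fun h' _ hne => by
        rw [Pi.mulSingle_eq_of_ne hne, map_one, one_zpow]) (by simp), Pi.mulSingle_eq_same]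
    rw [h2] at h1
    rw [h1, ← h2]
    refine Finset.prod_congr rfl fun h' _ => ?_
    congr 2
    rw [Pi.mulSingle_apply, Pi.mulSingle_apply]
    simp only [inv_mul_eq_iff_eq_mul]
  have hcen : ∀ h, x ^ n h ∈ Subgroup.center M := by
    intro h
    rw [Subgroup.mem_center_iff]
    intro m
    refine ((commutatorPairing_eq_one_iff hM.le _ _).1 ?_).symm
    rw [map_zpow, MonoidHom.zpow_apply]
    have h1 : (commutatorPairing hM.le x m ^ n h) ^ q = 1 := by rw [← hq, pow_card_eq_one']
    have h2 : (commutatorPairing hM.le x m ^ n h) ^ Nat.card R = 1 := by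
      have h3 : ∏ s : R, commutatorPairing hM.le x m ^ n (s * h) = 1 := by
        have h4 := map_prod_eq_zpow_sum (MonoidHom.id _) Finset.univ
          (fun s : R => commutatorPairing hM.le x m ^ n (s * h)) _ (fun s => n (s * h))
          (fun _ => rfl)
        rwa [hn, zpow_zero] at h4
      rwa [Finset.prod_congr rfl (fun s _ => hinv s h m), Finset.prod_const, Finset.card_univ,
        ← Nat.card_eq_fintype_card] at h3
    have h4 := pow_gcd_eq_one.2 ⟨h2, h1⟩
    rwa [hcop, pow_one] at h4
  -- The exponents sum to zero over each coset of `R`, and hence over `Γ`.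
  have hsum : ∑ h, n h = 0 := by
    have h1 : ∑ h, ∑ s : R, n (s * h) = Fintype.card R * ∑ h, n h := by
      rw [Finset.sum_comm, Finset.sum_congr rfl (fun (s : R) _ =>
        Fintype.sum_equiv (Equiv.mulLeft (s : Γ)) (fun h => n (s * h)) n (fun _ => rfl)),
        Finset.sum_const, Finset.card_univ, nsmul_eq_mul]
    rw [Finset.sum_congr rfl (fun h _ => hn h), Finset.sum_const_zero, eq_comm, mul_eq_zero] at h1
    exact h1.resolve_left (by exact_mod_cast Fintype.card_ne_zero)
  refine Subtype.ext (hdn.trans ?_)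
  refine (baseMk_centerPi_eq_one_iff hM (fun h => ⟨x ^ n h, hcen h⟩)).2 (Subtype.ext ?_)
  have h5 := map_prod_eq_zpow_sum (Subgroup.center M).subtype Finset.univ
    (fun h => ⟨x ^ n h, hcen h⟩) x n (fun _ => rfl)
  rwa [hsum, zpow_zero] at h5

end BaseQuotient

/-! ### One step of the tower -/

section NextGroup

variable {M Γ : Type} [Group M] [Group Γ] {R : Subgroup Γ} (hR : R ≤ Subgroup.center Γ)

theorem inr_mul_inl_mul_inr_inv (g : Γ) (d : layer M Γ R) :
    (SemidirectProduct.inr g * SemidirectProduct.inl d * (SemidirectProduct.inr g)⁻¹ :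
      NextGroup M Γ R hR) = SemidirectProduct.inl (layerAction M Γ R hR g d) := by
  rw [SemidirectProduct.inl_aut, map_inv]

/-- A normal subgroup of `D ⋊ Γ` containing `R` contains `D`: for `b` in `B / [B', H]`, the map
`s ↦ b⁻¹ * b ^ s` from `R` to `D` is a homomorphism modulo the normal subgroup, and it is trivial
because `|R|` is prime to `|M|`. -/
theorem inl_mem_of_inr_mem [Finite R] (hcop : (Nat.card R).Coprime (Nat.card M))
    (N : Subgroup (NextGroup M Γ R hR)) [N.Normal]
    (hN : ∀ s ∈ R, (SemidirectProduct.inr s : NextGroup M Γ R hR) ∈ N) (d : layer M Γ R) :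
    (SemidirectProduct.inl d : NextGroup M Γ R hR) ∈ N := by
  let N' : Subgroup (layer M Γ R) := N.comap SemidirectProduct.inl
  -- Modulo `N`, the group `R` acts trivially on `D`.
  have hact : ∀ s ∈ R, ∀ d : layer M Γ R, (layerAction M Γ R hR s d : layer M Γ R ⧸ N') = d := by
    intro s hs d
    rw [eq_comm, QuotientGroup.eq, Subgroup.mem_comap, map_mul, map_inv,
      ← inr_mul_inl_mul_inr_inv, ← mul_assoc, ← mul_assoc]
    refine N.mul_mem ?_ (inv_mem (hN s hs))
    simpa using Subgroup.Normal.conj_mem ‹N.Normal› _ (hN s hs) (SemidirectProduct.inl d)⁻¹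
  have hgen : ∀ (b : BaseQuotient M Γ) (s : Γ) (hs : s ∈ R),
      (⟨_, inv_mul_mem_layer hs b⟩ : layer M Γ R) ∈ N' := by
    intro b s hs
    let f : R →* layer M Γ R ⧸ N' := MonoidHom.mk'
      (fun s => ((⟨_, inv_mul_mem_layer s.2 b⟩ : layer M Γ R) : layer M Γ R ⧸ N')) (by
        intro s t
        rw [← hact s s.2 ⟨_, inv_mul_mem_layer t.2 b⟩, ← QuotientGroup.mk_mul]
        congr 1
        refine Subtype.ext ?_
        change b⁻¹ * baseQuotientAction M Γ (s * t) b =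
          b⁻¹ * baseQuotientAction M Γ s b *
            baseQuotientAction M Γ s (b⁻¹ * baseQuotientAction M Γ t b)
        simp [mul_assoc])
    have h1 : f ⟨s, hs⟩ ^ Nat.card R = 1 := by rw [← map_pow, pow_card_eq_one', map_one]
    have h2 : f ⟨s, hs⟩ ^ Nat.card M = 1 := by
      change ((⟨_, inv_mul_mem_layer hs b⟩ : layer M Γ R) : layer M Γ R ⧸ N') ^ _ = 1
      rw [← QuotientGroup.mk_pow]
      convert QuotientGroup.mk_one N'
      refine Subtype.ext ?_
      obtain ⟨c, hc⟩ := baseMk_surjective (b⁻¹ * baseQuotientAction M Γ s b)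
      change (b⁻¹ * baseQuotientAction M Γ s b) ^ Nat.card M = 1
      rw [← hc, ← map_pow]
      convert map_one (baseMk M Γ)
      funext h
      exact pow_card_eq_one'
    have h3 := pow_gcd_eq_one.2 ⟨h1, h2⟩
    rw [hcop, pow_one] at h3
    exact (QuotientGroup.eq_one_iff _).1 h3
  have hle : layer M Γ R ≤ N'.map (layer M Γ R).subtype := by
    refine (Subgroup.closure_le _).2 ?_
    rintro _ ⟨b, s, hs, rfl⟩
    exact ⟨_, hgen b s hs, rfl⟩
  obtain ⟨d', hd', h⟩ := hle d.2
  rwa [← Subtype.ext h]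

theorem exists_inr_mem_mul [Finite R] (hcop : (Nat.card R).Coprime (Nat.card M))
    (N : Subgroup (NextGroup M Γ R hR)) [N.Normal]
    (hN : ∀ s ∈ R, (SemidirectProduct.inr s : NextGroup M Γ R hR) ∈ N)
    (x : NextGroup M Γ R hR) : ∃ g : Γ, x * (SemidirectProduct.inr g)⁻¹ ∈ N := by
  refine ⟨x.right, ?_⟩
  have h := inl_mem_of_inr_mem hR hcop N hN x.left
  nth_rewrite 1 [← SemidirectProduct.inl_left_mul_inr_right x]
  rwa [mul_inv_cancel_right]

variable {q : ℕ}

theorem exists_commutatorPairing_ne_one (hM : commutator M = Subgroup.center M)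
    (hcen : Nat.card (Subgroup.center M) ≠ 1) :
    ∃ x m, commutatorPairing hM.le x m ≠ 1 := by
  by_contra! h
  have h1 : commutator M = ⊥ := by
    rw [commutator_eq_bot_iff_center_eq_top, eq_top_iff]
    intro x _
    exact Subgroup.mem_center_iff.2 fun m =>
      ((commutatorPairing_eq_one_iff hM.le x m).1 (h x m)).symm
  rw [← hM, h1] at hcen
  exact hcen (by simp)

/-- No nontrivial element of `Γ` fixes the character `evalPairing hM m` of the abelian subgroup
`layerPowers R x` of the layer. For `s ≠ 1` in `R`, on the family with exponent `1` at `s` and `-1`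
at `1` the two values differ by the factor `[x, m]`, or `[x, m] ^ 2` if `s = g⁻¹`. -/
theorem exists_evalPairing_ne [DecidableEq Γ] (hM : commutator M = Subgroup.center M)
    (hq : Nat.card (Subgroup.center M) = q) [Fintype R] (hR1 : R ≠ ⊥)
    (hcop : (Nat.card R).Coprime q) {x m : M} (hxm : commutatorPairing hM.le x m ≠ 1) (g : Γ)
    (hg : g ≠ 1) : ∃ d ∈ layerPowers (M := M) R x,
      evalPairing hM m (layerAction M Γ R hR g d : BaseQuotient M Γ) ≠
        evalPairing hM m (d : BaseQuotient M Γ) := by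
  set ζ := commutatorPairing hM.le x m with hζ
  obtain ⟨⟨s, hs⟩, hs1'⟩ := Subgroup.ne_bot_iff_exists_ne_one.1 hR1
  have hs1 : s ≠ 1 := fun h => hs1' (Subtype.ext h)
  have hval : ∀ s ∈ R, s ≠ 1 → (ζ ^ ((Pi.single s 1 : Γ → ℤ) g⁻¹ + 1) ≠ 1) →
      ∃ d ∈ layerPowers (M := M) R x,
      evalPairing hM m (layerAction M Γ R hR g d : BaseQuotient M Γ) ≠
        evalPairing hM m (d : BaseQuotient M Γ) := by
    intro s hs hs1 hne
    refine ⟨_, powFamily_sub_mem_layerPowers R hs x, fun h => hne ?_⟩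
    change evalPairing hM m (baseQuotientAction M Γ g (powFamily M Γ x _)) =
      evalPairing hM m (powFamily M Γ x _) at h
    rw [baseQuotientAction_powFamily, evalPairing_powFamily, evalPairing_powFamily, ← hζ] at h
    simp only [Pi.sub_apply, mul_one, Pi.single_eq_of_ne (inv_ne_one.2 hg), Pi.single_eq_same,
      sub_zero, Pi.single_eq_of_ne hs1.symm, zero_sub] at h
    rw [zpow_add, h, ← zpow_add, neg_add_cancel, zpow_zero]
  by_cases hsg : g⁻¹ = s
  · by_cases hζ2 : ζ ^ 2 = 1
    -- Here `q = 2`, so `R` has odd order and `s⁻¹ ≠ s`.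
    · refine hval s⁻¹ (inv_mem hs) (inv_ne_one.2 hs1) ?_
      have hss : s ≠ s⁻¹ := by
        intro hss
        have h1 : (⟨s, hs⟩ : R) ^ 2 = 1 := Subtype.ext (by
          change s ^ 2 = 1
          rw [pow_two, ← eq_inv_iff_mul_eq_one]
          exact hss)
        have h2 : orderOf (⟨s, hs⟩ : R) = 2 :=
          orderOf_eq_prime h1 (fun h => hs1 (congrArg Subtype.val h))
        have h3 : orderOf ζ = 2 := orderOf_eq_prime hζ2 hxm
        have h4 := Nat.dvd_gcd (h2 ▸ orderOf_dvd_natCard (⟨s, hs⟩ : R))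
          (hq ▸ h3 ▸ orderOf_dvd_natCard ζ)
        rw [hcop] at h4
        omega
      rw [hsg, Pi.single_eq_of_ne hss]
      simpa using hxm
    · refine hval s hs hs1 ?_
      rw [hsg, Pi.single_eq_same]
      exact_mod_cast hζ2
  · refine hval s hs hs1 ?_
    rw [Pi.single_eq_of_ne hsg]
    simpa using hxm

/-- The derived subgroup of the layer has the order of the centre of `M`. -/
theorem card_nextCentral [Fintype Γ] (hM : commutator M = Subgroup.center M)
    (hq : Nat.card (Subgroup.center M) = q) (hqp : q.Prime) (hR1 : R ≠ ⊥)
    (hcop : (Nat.card R).Coprime q) : Nat.card (nextCentral M Γ R hR) = q := by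
  classical
  have := Fintype.ofFinite R
  obtain ⟨x, m, hxm⟩ := exists_commutatorPairing_ne_one hM (hq ▸ hqp.ne_one)
  have hne : commutator (layer M Γ R) ≠ ⊥ := by
    intro h
    rw [commutator_eq_bot_iff_center_eq_top, eq_top_iff] at h
    obtain ⟨s, hs⟩ := Subgroup.ne_bot_iff_exists_ne_one.1 hR1
    obtain ⟨d, hd, hne⟩ := exists_evalPairing_ne hR hM hq hR1 hcop hxm (s : Γ)
      (fun h => hs (Subtype.ext h))
    have h1 : d = 1 := eq_one_of_mem_layerPowers hM hq R hcop x hd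
      (fun d' => (Subgroup.mem_center_iff.1 (h (Subgroup.mem_top d)) d').symm)
    exact hne (by rw [h1, map_one])
  have hle : (commutator (layer M Γ R)).map (layer M Γ R).subtype ≤ (centerMk M Γ).range := by
    refine le_trans ?_ (commutator_baseQuotient_le hM)
    rw [commutator_def, commutator_def, Subgroup.map_commutator]
    exact Subgroup.commutator_mono le_top le_top
  have hcard : Nat.card (centerMk M Γ).range = q := by
    rw [← hq]
    exact (Nat.card_congr (MonoidHom.ofInjective (centerMk_injective hM)).toEquiv).symm
  have h1 : Nat.card (nextCentral M Γ R hR) =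
      Nat.card ((commutator (layer M Γ R)).map (layer M Γ R).subtype) := by
    rw [nextCentral, Subgroup.card_map_of_injective SemidirectProduct.inl_injective,
      Subgroup.card_map_of_injective (Subgroup.subtype_injective _)]
  rw [h1]
  refine ((Nat.dvd_prime hqp).1 (hcard ▸ Subgroup.card_dvd_of_le hle)).resolve_left fun h => ?_
  rw [Subgroup.card_eq_one, Subgroup.map_eq_bot_iff_of_injective _
    (Subgroup.subtype_injective _)] at h
  exact hne h

theorem finite_nextGroup [Finite Γ] [Finite M] : Finite (NextGroup M Γ R hR) :=
  Finite.of_equiv _ SemidirectProduct.equivProd.symm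

open MonoidAlgebra in
/-- An ideal of the group algebra of `D ⋊ Γ` that meets the group algebra of `Γ` contains
`z - 1` for all `z` in `D'`, when the prime `q` differs from the characteristic. -/
theorem of_sub_one_mem_of_mem_nextCentral [Fintype Γ] {K : Type*} [Field K]
    (hM : commutator M = Subgroup.center M)
    (hq : Nat.card (Subgroup.center M) = q) (hqp : q.Prime) (hqK : (q : K) ≠ 0) (hR1 : R ≠ ⊥)
    (hcop : (Nat.card R).Coprime q) (J : Ideal (MonoidAlgebra K (NextGroup M Γ R hR)))
    [J.IsTwoSided] (y : MonoidAlgebra K Γ) (hy : y ≠ 0)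
    (hyJ : mapDomainRingHom K (SemidirectProduct.inr : Γ →* NextGroup M Γ R hR) y ∈ J)
    (z : NextGroup M Γ R hR) (hz : z ∈ nextCentral M Γ R hR) :
    of K _ z - 1 ∈ J := by
  classical
  have := Fintype.ofFinite R
  obtain ⟨x, m, hxm⟩ := exists_commutatorPairing_ne_one hM (hq ▸ hqp.ne_one)
  let A : Subgroup (NextGroup M Γ R hR) := (layerPowers R x).map SemidirectProduct.inl
  have : IsMulCommutative A := by
    refine ⟨⟨?_⟩⟩
    rintro ⟨_, d, hd, rfl⟩ ⟨_, d', hd', rfl⟩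
    refine Subtype.ext ?_
    change SemidirectProduct.inl d * SemidirectProduct.inl d' =
      SemidirectProduct.inl d' * SemidirectProduct.inl d
    rw [← map_mul, ← map_mul]
    congr 1
    exact congrArg Subtype.val (mul_comm (⟨d, hd⟩ : layerPowers R x) ⟨d', hd'⟩)
  have hA : ∀ g : Γ, ∀ a ∈ A, (SemidirectProduct.inr g * a * (SemidirectProduct.inr g)⁻¹ :
      NextGroup M Γ R hR) ∈ A := by
    rintro g _ ⟨d, hd, rfl⟩
    rw [inr_mul_inl_mul_inr_inv]
    exact Subgroup.mem_map_of_mem _ (layerAction_mem_layerPowers R hR x g hd)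
  let χ : A →* Subgroup.center M := MonoidHom.mk'
    (fun a => evalPairing hM m ((a : NextGroup M Γ R hR).left : BaseQuotient M Γ)) (by
      rintro ⟨_, d, hd, rfl⟩ ⟨_, d', hd', rfl⟩
      simp)
  obtain ⟨w, hw, hwJ⟩ := exists_mapDomain_mem_of_mapDomain_mem SemidirectProduct.inr A hA χ
    (hq ▸ hqp) (hq ▸ hqK) (fun g hg => by
      obtain ⟨d, hd, hne⟩ := exists_evalPairing_ne hR hM hq hR1 hcop hxm g hg
      refine ⟨⟨_, d, hd, rfl⟩, ?_⟩
      simpa [χ, inr_mul_inl_mul_inr_inv] using hne) J y hy hyJ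
  have hcard := card_nextCentral hR hM hq hqp hR1 hcop
  have hcl : ∀ d d' : layer M Γ R, ⁅(SemidirectProduct.inl d : NextGroup M Γ R hR),
      SemidirectProduct.inl d'⁆ ∈ nextCentral M Γ R hR := by
    intro d d'
    rw [← map_commutatorElement]
    exact Subgroup.mem_map_of_mem _
      (Subgroup.commutator_mem_commutator (Subgroup.mem_top _) (Subgroup.mem_top _))
  refine of_sub_one_mem_of_mapDomain_mem (nextCentral M Γ R hR) A
    (nextCentral_le_center M Γ R hR) (hcard ▸ hqp) (hcard ▸ hqK) ?_ J w hw hwJ z hz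
  rintro _ ⟨d, hd, rfl⟩ hd1
  obtain ⟨d', hd'⟩ : ∃ d', ¬ d * d' = d' * d := by
    by_contra! h
    exact hd1 (by rw [eq_one_of_mem_layerPowers hM hq R hcop x hd h, map_one])
  refine ⟨SemidirectProduct.inl d', ?_, fun h => hd' ?_⟩
  · rintro _ ⟨d'', hd'', rfl⟩
    exact hcl _ _
  · rw [commutatorElement_eq_one_iff_mul_comm, ← map_mul, ← map_mul] at h
    exact (SemidirectProduct.inl_injective h).symm

end NextGroup

/-! ### Ideals of finite codimension -/

section FiniteCodimension

open MonoidAlgebra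

variable {K G : Type*} [Field K] [Group G]

/-- The normal subgroup of the elements `g` such that `g - 1` lies in the ideal `I`. -/
noncomputable def idealKernel (I : Ideal (MonoidAlgebra K G)) [I.IsTwoSided] : Subgroup G :=
  ((Ideal.Quotient.mk I : MonoidAlgebra K G →* MonoidAlgebra K G ⧸ I).comp (of K G)).ker

instance (I : Ideal (MonoidAlgebra K G)) [I.IsTwoSided] : (idealKernel I).Normal :=
  MonoidHom.normal_ker _

theorem mem_idealKernel {I : Ideal (MonoidAlgebra K G)} [I.IsTwoSided] {g : G} :
    g ∈ idealKernel I ↔ of K G g - 1 ∈ I := by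
  rw [← map_one (of K G), ← Ideal.Quotient.eq]
  exact Iff.rfl

/-- An ideal `I` has finite codimension when a finite subgroup of `G` maps onto the quotient
by `idealKernel I`. -/
theorem finiteDimensional_quotient_of_exists_mem_idealKernel {H : Type*} [Group H] [Finite H]
    (I : Ideal (MonoidAlgebra K G)) [I.IsTwoSided] (j : H →* G)
    (h : ∀ x : G, ∃ g : H, x * (j g)⁻¹ ∈ idealKernel I) :
    FiniteDimensional K (MonoidAlgebra K G ⧸ I) := by
  let f : MonoidAlgebra K H →ₗ[K] MonoidAlgebra K G ⧸ I :=
    (Ideal.Quotient.mkₐ K I).toLinearMap.comp (mapDomainAlgHom K K j).toLinearMap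
  have hf : Function.Surjective f := by
    rw [← LinearMap.range_eq_top, eq_top_iff]
    rintro y -
    obtain ⟨y, rfl⟩ := Ideal.Quotient.mk_surjective y
    induction y using MonoidAlgebra.induction_on with
    | of x =>
      obtain ⟨g, hg⟩ := h x
      refine ⟨of K H g, ?_⟩
      change Ideal.Quotient.mk I (mapDomainRingHom K j (of K H g)) = _
      rw [eq_comm, Ideal.Quotient.eq]
      have h1 := I.mul_mem_right (of K G (j g)) (mem_idealKernel.1 hg)
      rw [sub_mul, ← map_mul, one_mul, inv_mul_cancel_right] at h1
      simpa [of_apply] using h1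
    | add x y hx hy =>
      rw [map_add]
      exact Submodule.add_mem _ hx hy
    | smul r x hx =>
      exact Submodule.smul_mem _ r hx
  exact Module.Finite.of_surjective f hf

end FiniteCodimension

/-! ### The limit of the tower -/

section Limit

open MonoidAlgebra

variable (p : ℕ → ℕ) (M : ℕ → Type) [∀ n, Group (M n)]

/-- The canonical homomorphism from a group of the tower to the limit. -/
noncomputable def towerOf (n : ℕ) : (tower p M n).carrier →* towerLimit p M :=
  MonoidHom.mk' (fun x => (⟦⟨n, x⟩⟧ : towerLimit p M)) fun x y =>
    (DirectLimit.mul_def (f := towerMap p M) n x y).symm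

theorem towerOf_towerMap (m n : ℕ) (h : m ≤ n) (x : (tower p M m).carrier) :
    towerOf p M n (towerMap p M m n h x) = towerOf p M m x :=
  DirectLimit.mk_apply (F := fun n => (tower p M n).carrier) (f := towerMap p M) m n x h

theorem towerOf_towerSucc (n : ℕ) (x : (tower p M n).carrier) :
    towerOf p M (n + 1) (towerSucc p M n x) = towerOf p M n x := by
  rw [← towerOf_towerMap p M n (n + 1) n.le_succ, towerMap_succ p M n n le_rfl, towerMap_self]

theorem exists_towerOf_eq (x : towerLimit p M) : ∃ N, ∀ n ≥ N, ∃ y, towerOf p M n y = x := by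
  induction x using DirectLimit.induction with
  | ih i x => exact ⟨i, fun n hn => ⟨towerMap p M i n hn x, towerOf_towerMap p M i n hn x⟩⟩

theorem exists_mapDomain_towerOf_eq {K : Type*} [Field K] (a : MonoidAlgebra K (towerLimit p M)) :
    ∃ N, ∀ n ≥ N, ∃ b, mapDomainRingHom K (towerOf p M n) b = a := by
  induction a using MonoidAlgebra.induction_linear with
  | zero => exact ⟨0, fun n _ => ⟨0, map_zero _⟩⟩
  | add a a' ha ha' =>
    obtain ⟨N, hN⟩ := ha
    obtain ⟨N', hN'⟩ := ha'
    refine ⟨max N N', fun n hn => ?_⟩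
    obtain ⟨b, rfl⟩ := hN n (le_of_max_le_left hn)
    obtain ⟨b', rfl⟩ := hN' n (le_of_max_le_right hn)
    exact ⟨b + b', map_add _ _ _⟩
  | single x r =>
    obtain ⟨N, hN⟩ := exists_towerOf_eq p M x
    refine ⟨N, fun n hn => ?_⟩
    obtain ⟨y, rfl⟩ := hN n hn
    exact ⟨single y r, by simp⟩

variable {p M}

theorem tower_finite_and_card_central (hp : ∀ i, (p i).Prime) (hne : ∀ i, p (i + 1) ≠ p i)
    (hM : ∀ i, IsExtraSpecial (p (i + 1)) (M i)) (n : ℕ) :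
    Finite (tower p M n).carrier ∧ Nat.card (tower p M n).central = p n := by
  induction n with
  | zero =>
    have : NeZero (p 0) := ⟨(hp 0).ne_zero⟩
    refine ⟨inferInstanceAs (Finite (ZMod (p 0))), ?_⟩
    change Nat.card (⊤ : Subgroup (Multiplicative (ZMod (p 0)))) = p 0
    rw [Subgroup.card_top]
    exact Nat.card_zmod (p 0)
  | succ n ih =>
    obtain ⟨h1, h2⟩ := ih
    have := (hM n).finite
    have := Fintype.ofFinite (tower p M n).carrier
    refine ⟨finite_nextGroup (tower p M n).central_le, ?_⟩
    refine card_nextCentral (tower p M n).central_le (hM n).commutator_eq_center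
      (hM n).card_center (hp _) ?_ ?_
    · intro h
      rw [h, Subgroup.card_bot] at h2
      exact (hp n).ne_one h2.symm
    · rw [h2]
      exact (Nat.coprime_primes (hp _) (hp _)).2 (hne n).symm

/-- A normal subgroup of the limit that contains `R_n` also contains `R_{n+1}`, and `G_{n+1}` is
covered by it and `G_n`. -/
theorem towerOf_mem_of_forall_central (hp : ∀ i, (p i).Prime) (hne : ∀ i, p (i + 1) ≠ p i)
    (hM : ∀ i, IsExtraSpecial (p (i + 1)) (M i)) (N : Subgroup (towerLimit p M)) [N.Normal] (n : ℕ)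
    (hN : ∀ r ∈ (tower p M n).central, towerOf p M n r ∈ N) :
    (∀ r ∈ (tower p M (n + 1)).central, towerOf p M (n + 1) r ∈ N) ∧
      ∀ x, ∃ y, towerOf p M (n + 1) x * (towerOf p M n y)⁻¹ ∈ N := by
  obtain ⟨h1, h2⟩ := tower_finite_and_card_central hp hne hM n
  have := (hM n).finite
  have : Fact (p (n + 1)).Prime := ⟨hp _⟩
  obtain ⟨k, hk⟩ := IsPGroup.iff_card.1 (hM n).isPGroup
  have hcop : (Nat.card (tower p M n).central).Coprime (Nat.card (M n)) := by
    rw [h2, hk]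
    exact Nat.Coprime.pow_right _ ((Nat.coprime_primes (hp _) (hp _)).2 (hne n).symm)
  have hN' : ∀ s ∈ (tower p M n).central, towerSucc p M n s ∈ N.comap (towerOf p M (n + 1)) := by
    intro s hs
    rw [Subgroup.mem_comap, towerOf_towerSucc]
    exact hN s hs
  let t : NextGroup (M n) (tower p M n).carrier (tower p M n).central (tower p M n).central_le →*
    towerLimit p M := towerOf p M (n + 1)
  constructor
  · rintro _ ⟨d, -, rfl⟩
    exact inl_mem_of_inr_mem (tower p M n).central_le hcop (N.comap t) hN' d
  · intro x
    obtain ⟨y, hy⟩ := exists_inr_mem_mul (tower p M n).central_le hcop (N.comap t) hN' x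
    refine ⟨y, ?_⟩
    have hy' : x * (towerSucc p M n y)⁻¹ ∈ N.comap (towerOf p M (n + 1)) := hy
    rwa [Subgroup.mem_comap, map_mul, map_inv, towerOf_towerSucc] at hy'

/-- A normal subgroup of the limit that contains `R_m` has finite index: it covers the limit
together with `G_m`. -/
theorem exists_towerOf_mul_inv_mem (hp : ∀ i, (p i).Prime) (hne : ∀ i, p (i + 1) ≠ p i)
    (hM : ∀ i, IsExtraSpecial (p (i + 1)) (M i)) (N : Subgroup (towerLimit p M)) [N.Normal] (m : ℕ)
    (hN : ∀ r ∈ (tower p M m).central, towerOf p M m r ∈ N) (x : towerLimit p M) :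
    ∃ y, x * (towerOf p M m y)⁻¹ ∈ N := by
  have key : ∀ n ≥ m, (∀ r ∈ (tower p M n).central, towerOf p M n r ∈ N) ∧
      ∀ x, ∃ y, towerOf p M n x * (towerOf p M m y)⁻¹ ∈ N := by
    intro n hn
    induction n, hn using Nat.le_induction with
    | base => exact ⟨hN, fun x => ⟨x, by rw [mul_inv_cancel]; exact N.one_mem⟩⟩
    | succ n _ ih =>
      obtain ⟨h1, h2⟩ := towerOf_mem_of_forall_central hp hne hM N n ih.1
      refine ⟨h1, fun x => ?_⟩
      obtain ⟨y, hy⟩ := h2 x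
      obtain ⟨z, hz⟩ := ih.2 y
      refine ⟨z, ?_⟩
      simpa [mul_assoc] using N.mul_mem hy hz
  obtain ⟨k, hk⟩ := exists_towerOf_eq p M x
  obtain ⟨y, rfl⟩ := hk (max k m) (le_max_left _ _)
  exact (key _ (le_max_right _ _)).2 y

end Limit

open MonoidAlgebra in
theorem theorem2p9 (p : ℕ → ℕ) (hp : ∀ i, (p i).Prime) (hne : ∀ i, p (i + 1) ≠ p i)
    (M : ℕ → Type) [∀ i, Group (M i)]
    (hM : ∀ i, IsExtraSpecial (p (i + 1)) (M i)) (hcard : ∀ i, Nat.card (M i) = p (i + 1) ^ 3)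
    (K : Type*) [Field K] (c : ℕ) [CharP K c]
    (huv : ∀ i, ∃ u v, i < u ∧ u < v ∧ p u = p v ∧ p u ≠ c)
    (I : Ideal (MonoidAlgebra K (towerLimit p M))) [I.IsTwoSided] (hI : I ≠ ⊥) :
    FiniteDimensional K (MonoidAlgebra K (towerLimit p M) ⧸ I) := by
  obtain ⟨a, haI, ha⟩ := Submodule.exists_mem_ne_zero_of_ne_bot hI
  obtain ⟨N, hN⟩ := exists_mapDomain_towerOf_eq p M a
  obtain ⟨u, _, hNu, -, -, huc⟩ := huv N
  obtain ⟨n, rfl⟩ := Nat.exists_eq_add_one_of_ne_zero (Nat.ne_zero_of_lt hNu)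
  obtain ⟨b, rfl⟩ := hN n (Nat.le_of_lt_succ hNu)
  obtain ⟨_, hcen⟩ := tower_finite_and_card_central hp hne hM n
  have := (tower_finite_and_card_central hp hne hM (n + 1)).1
  have := Fintype.ofFinite (tower p M n).carrier
  have hpK : (p (n + 1) : K) ≠ 0 := by
    rw [Ne, CharP.cast_eq_zero_iff K c]
    intro h
    rcases (Nat.dvd_prime (hp _)).1 h with h1 | h1
    · exact CharP.char_ne_one K c h1
    · exact huc h1.symm
  have hR1 : (tower p M n).central ≠ ⊥ := by
    intro h
    rw [h, Subgroup.card_bot] at hcen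
    exact (hp n).ne_one hcen.symm
  have hcop : (Nat.card (tower p M n).central).Coprime (p (n + 1)) := by
    rw [hcen]
    exact (Nat.coprime_primes (hp _) (hp _)).2 (hne n).symm
  let t : NextGroup (M n) (tower p M n).carrier (tower p M n).central (tower p M n).central_le →*
    towerLimit p M := towerOf p M (n + 1)
  let φ := mapDomainRingHom K t
  have hb : mapDomainRingHom K (SemidirectProduct.inr : (tower p M n).carrier →*
      NextGroup (M n) (tower p M n).carrier (tower p M n).central (tower p M n).central_le) b ∈
      I.comap φ := by
    rw [Ideal.mem_comap]
    convert haI using 1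
    rw [← RingHom.comp_apply, ← mapDomainRingHom_comp]
    congr 2
    ext x
    exact towerOf_towerSucc p M n x
  have hφ : ∀ r, φ (of K _ r) = of K _ (t r) := fun r => by simp [φ, of_apply]
  have hmem : ∀ r ∈ nextCentral (M n) (tower p M n).carrier (tower p M n).central
      (tower p M n).central_le, of K _ (t r) - 1 ∈ I := by
    intro r hr
    have h1 := of_sub_one_mem_of_mem_nextCentral (tower p M n).central_le
      (hM n).commutator_eq_center (hM n).card_center (hp (n + 1)) hpK hR1 hcop (I.comap φ) b
      (fun h => ha (by rw [h, map_zero])) hb r hr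
    rwa [Ideal.mem_comap, map_sub, map_one, hφ] at h1
  exact finiteDimensional_quotient_of_exists_mem_idealKernel I (towerOf p M (n + 1))
    (exists_towerOf_mul_inv_mem hp hne hM (idealKernel I) (n + 1)
      fun r hr => mem_idealKernel.2 (hmem r hr))
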